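/- Let $R$ be a $\lambda$-ring (in the sense also called "special $\lambda$-ring": a commutative ring with operations $\lambda^n$, $n\ge 0$, such that $\lambda^0(x)=1$, $\lambda^1(x)=x$, $\lambda^n(x+y)=\sum_{i+j=n}\lambda^i(x)\lambda^j(y)$, $\lambda^n(1)=0$ for $n\ge2$, and $\lambda^n(xy)$, $\lambda^m(\lambda^n(x))$ are given by the usual universal polynomials in the $\lambda^i(x),\lambda^j(y)$), let $x\in R$, and put $\lambda_t(x)=\sum_{n\ge0}\lambda^n(x)t^n\in R[[t]]$. Let $\Lambda=\mathbb{Z}[e_1,e_2,\dots]$ be the ring of symmetric functions, and for a partition $\pi$ let $s_\pi\in\Lambda$ be its Schur function (in $n\ge\ell(\pi)$ variables, $s_\pi=\det(\xi_i^{\pi_j+n-j})/\det(\xi_i^{n-j})$). For $f\in\Lambda$ write $f(x)=u_x(f)$, where $u_x:\Lambda\to R$ is the ring homomorphism with $u_x(e_n)=\lambda^n(x)$. A partition $\pi$ contains $\mu$ if the Young diagram of $\pi$ contains that of $\mu$; $\pi'$ denotes the conjugate partition. - $x$ is *Schur-finite* if there is a partition $\mu$ such that $s_\pi(x)=0$ for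 every partition $\pi$ containing $\mu$. - For $f(t)=\sum_{n\ge0} r_nt^n\in R[[t]]$ and a partition $\pi$ with $m$ columns, put $s_\pi(f)=\det\bigl(r_{\pi'_i+j-i}\bigr)_{1\le i,j\le m}$, where $r_k=0$ for $k<0$. The series $f$ is *Schur-rational* if there is a partition $\mu$ such that $s_\pi(f)=0$ for every partition $\pi$ containing $\mu$. - $f(t)=\sum r_nt^n$ is *determinantally rational* if there are integers $m,n_0>0$ such that $\det(r_{n+i+j})_{i,j=1}^m=0$ for all $n>n_0$. Then $x$ is Schur-finite if and only if the power series $\lambda_t(x)$ is Schur-rational. In particular, if $x$ is Schur-finite then $\lambda_t(x)$ is determinantally rational. -/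

import Mathlib

noncomputable section

namespace SchurFinite

open MvPolynomial

/-! ### The universal polynomials in the axioms of a λ-ring -/

/-- `P` is the universal polynomial `P_n(a_1, …, a_n; b_1, …, b_n)` for products: after substituting
for the `a_i` and `b_j` the elementary symmetric polynomials in `ξ_1, …, ξ_n` and `η_1, …, η_n`, it
becomes the coefficient of `t ^ n` in `∏_{i,j} (1 + ξ_i η_j t)`, i.e. the `n`-th elementary symmetric
polynomial of the `n²` products `ξ_i η_j`. (The variable with index `i : Fin n` stands for `a_{i+1}`,
resp. `b_{i+1}`.) -/
def IsProductPolynomial (n : ℕ) (P : MvPolynomial (Fin n ⊕ Fin n) ℤ) : Prop :=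
  aeval (Sum.elim
      (fun i : Fin n => rename Sum.inl (esymm (Fin n) ℤ (i + 1)))
      (fun j : Fin n => rename Sum.inr (esymm (Fin n) ℤ (j + 1)))) P =
    (aeval (fun p : Fin n × Fin n => X (Sum.inl p.1) * X (Sum.inr p.2))
      (esymm (Fin n × Fin n) ℤ n) : MvPolynomial (Fin n ⊕ Fin n) ℤ)

/-- `P` is the universal polynomial `P_{m,n}(a_1, …, a_{mn})` for compositions: after substituting for
the `a_i` the elementary symmetric polynomials in `ξ_1, …, ξ_{mn}`, it becomes the coefficient of
`t ^ m` in `∏_{i_1 < ⋯ < i_n} (1 + ξ_{i_1} ⋯ ξ_{i_n} t)`. -/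
def IsCompositionPolynomial (m n : ℕ) (P : MvPolynomial (Fin (m * n)) ℤ) : Prop :=
  aeval (fun i : Fin (m * n) => esymm (Fin (m * n)) ℤ (i + 1)) P =
    (aeval (fun s : {s : Finset (Fin (m * n)) // s.card = n} => ∏ i ∈ s.1, X i)
      (esymm {s : Finset (Fin (m * n)) // s.card = n} ℤ m) : MvPolynomial (Fin (m * n)) ℤ)

theorem aeval_esymm_eq_of_equiv {σ S : Type*} [Fintype σ] [CommRing S] [Algebra ℤ S] (e : σ ≃ σ)
    (f : σ → S) (n : ℕ) :
    aeval (fun s => f (e s)) (esymm σ ℤ n) = aeval f (esymm σ ℤ n) := by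
  conv_rhs => rw [← rename_esymm σ ℤ n e]
  rw [aeval_rename]
  rfl

theorem exists_aeval_esymm {n : ℕ} {A : Type*} [CommRing A] {F : MvPolynomial (Fin n) A}
    (hF : F.IsSymmetric) :
    ∃ P : MvPolynomial (Fin n) A, aeval (fun i : Fin n => esymm (Fin n) A (i + 1)) P = F := by
  obtain ⟨P, hP⟩ := esymmAlgHom_surjective (σ := Fin n) A (n := n) (by simp) ⟨F, hF⟩
  refine ⟨P, ?_⟩
  rw [← esymmAlgHom_apply, hP]

theorem map_aeval_esymm {n : ℕ} {A B : Type*} [CommRing A] [CommRing B] (g : A →+* B)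
    (Q : MvPolynomial (Fin n) A) :
    map g (aeval (fun i : Fin n => esymm (Fin n) A (i + 1)) Q) =
      aeval (fun i : Fin n => esymm (Fin n) B (i + 1)) (map g Q) := by
  induction Q using MvPolynomial.induction_on with
  | C a => simp
  | add p q hp hq => simp only [map_add, hp, hq]
  | mul_X p i hp => simp only [map_mul, hp, aeval_X, map_X, map_esymm]

theorem exists_isCompositionPolynomial (m n : ℕ) :
    ∃ P, IsCompositionPolynomial m n P := by
  apply exists_aeval_esymm
  intro e
  rw [← AlgHom.comp_apply, comp_aeval]
  let e' : {s : Finset (Fin (m * n)) // s.card = n} ≃ {s : Finset (Fin (m * n)) // s.card = n} :=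
    (Equiv.finsetCongr e).subtypeEquiv (by simp)
  rw [← aeval_esymm_eq_of_equiv e' (fun s => ∏ i ∈ s.1, X i)]
  congr 2
  funext s
  simp [e', map_prod]

theorem exists_isProductPolynomial (n : ℕ) : ∃ P, IsProductPolynomial n P := by
  set F : MvPolynomial (Fin n ⊕ Fin n) ℤ :=
    aeval (fun p : Fin n × Fin n => X (Sum.inl p.1) * X (Sum.inr p.2))
      (esymm (Fin n × Fin n) ℤ n) with hF
  have hsym : ∀ e f : Equiv.Perm (Fin n), rename (Equiv.sumCongr e f) F = F := by
    intro e f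
    rw [hF, ← AlgHom.comp_apply, comp_aeval, ← aeval_esymm_eq_of_equiv (Equiv.prodCongr e f)
      (fun p : Fin n × Fin n => X (Sum.inl p.1) * X (Sum.inr p.2))]
    congr 2
    funext p
    simp
  let Φ := sumAlgEquiv ℤ (Fin n) (Fin n)
  have h1 : ∀ (e : Equiv.Perm (Fin n)) (G : MvPolynomial (Fin n ⊕ Fin n) ℤ),
      rename e (Φ G) = Φ (rename (Equiv.sumCongr e (Equiv.refl _)) G) := by
    intro e G
    induction G using MvPolynomial.induction_on with
    | C a => simp [Φ]
    | add p q hp hq => simp only [map_add, hp, hq]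
    | mul_X p i hp => cases i <;> simp only [map_mul, hp] <;> simp [Φ]
  have h2 : ∀ (f : Equiv.Perm (Fin n)) (G : MvPolynomial (Fin n ⊕ Fin n) ℤ),
      map (rename f : _ →ₐ[ℤ] _).toRingHom (Φ G) =
        Φ (rename (Equiv.sumCongr (Equiv.refl _) f) G) := by
    intro f G
    induction G using MvPolynomial.induction_on with
    | C a => simp [Φ]
    | add p q hp hq => simp only [map_add, hp, hq]
    | mul_X p i hp => cases i <;> simp only [map_mul, hp] <;> simp [Φ]
  obtain ⟨Q, hQ⟩ := exists_aeval_esymm (F := Φ F) (fun e => by rw [h1, hsym])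
  have hQsym : ∀ f : Equiv.Perm (Fin n), map (rename f : _ →ₐ[ℤ] _).toRingHom Q = Q := by
    intro f
    apply esymmAlgHom_injective (σ := Fin n) (MvPolynomial (Fin n) ℤ) (n := n) (by simp)
    apply Subtype.ext
    rw [esymmAlgHom_apply, esymmAlgHom_apply, ← map_aeval_esymm, hQ, h2, hsym]
  have hmem : Q ∈ (map (aeval (fun j : Fin n => esymm (Fin n) ℤ (j + 1)) :
      MvPolynomial (Fin n) ℤ →ₐ[ℤ] MvPolynomial (Fin n) ℤ).toRingHom).range := by
    rw [RingHom.mem_range, ← Set.mem_range, mem_range_map_iff_coeffs_subset]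
    intro c hc
    rw [Finset.mem_coe, mem_coeffs_iff] at hc
    obtain ⟨k, -, rfl⟩ := hc
    have hk : (coeff k Q).IsSymmetric := by
      intro f
      conv_rhs => rw [← hQsym f]
      rw [coeff_map]
      rfl
    obtain ⟨q, hq⟩ := exists_aeval_esymm hk
    exact ⟨q, hq⟩
  obtain ⟨Q', rfl⟩ := hmem
  refine ⟨Φ.symm Q', ?_⟩
  have key : ∀ P : MvPolynomial (Fin n ⊕ Fin n) ℤ,
      Φ (aeval (Sum.elim
        (fun i : Fin n => rename Sum.inl (esymm (Fin n) ℤ (i + 1)))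
        (fun j : Fin n => rename Sum.inr (esymm (Fin n) ℤ (j + 1)))) P) =
      aeval (fun i : Fin n => esymm (Fin n) (MvPolynomial (Fin n) ℤ) (i + 1))
        (map (aeval (fun j : Fin n => esymm (Fin n) ℤ (j + 1)) :
          MvPolynomial (Fin n) ℤ →ₐ[ℤ] MvPolynomial (Fin n) ℤ).toRingHom (Φ P)) := by
    have hl : ∀ G : MvPolynomial (Fin n) ℤ, Φ (rename Sum.inl G) = map C G := by
      intro G
      induction G using MvPolynomial.induction_on with
      | C a => simp [Φ]
      | add p q hp hq => simp only [map_add, hp, hq]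
      | mul_X p i hp => simp only [map_mul, hp]; simp [Φ]
    have hr : ∀ G : MvPolynomial (Fin n) ℤ, Φ (rename Sum.inr G) = C G := by
      intro G
      induction G using MvPolynomial.induction_on with
      | C a => simp [Φ]
      | add p q hp hq => simp only [map_add, hp, hq]
      | mul_X p i hp => simp only [map_mul, hp]; simp [Φ]
    intro P
    induction P using MvPolynomial.induction_on with
    | C a => simp [Φ]
    | add p q hp hq => simp only [map_add, hp, hq]
    | mul_X p i hp =>
      simp only [map_mul, hp, aeval_X]
      congr 1
      rcases i with i | i
      · simp only [Sum.elim_inl, hl, map_esymm, Φ, sumAlgEquiv_X_inl, map_X, aeval_X]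
      · simp only [Sum.elim_inr, hr, Φ, sumAlgEquiv_X_inr, map_C]
        simp
  apply Φ.injective
  rw [key, AlgEquiv.apply_symm_apply, hQ]

/-- The universal polynomial `P_n`. -/
def productPolynomial (n : ℕ) : MvPolynomial (Fin n ⊕ Fin n) ℤ :=
  (exists_isProductPolynomial n).choose

/-- The universal polynomial `P_{m,n}`. -/
def compositionPolynomial (m n : ℕ) : MvPolynomial (Fin (m * n)) ℤ :=
  (exists_isCompositionPolynomial m n).choose

/-! ### λ-rings -/

/-- A λ-ring (a "special λ-ring" in the older terminology): a commutative ring with operations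
`lam n = λ^n` such that `λ^0 = 1`, `λ^1 = id`, `λ_t(x + y) = λ_t(x) λ_t(y)`, `λ_t(1) = 1 + t`, and
`λ^n(x y)`, `λ^m(λ^n(x))` are given by the universal polynomials. -/
class LambdaRing (R : Type*) extends CommRing R where
  lam : ℕ → R → R
  lam_zero : ∀ x, lam 0 x = 1
  lam_one : ∀ x, lam 1 x = x
  lam_add : ∀ n x y, lam n (x + y) = ∑ p ∈ Finset.HasAntidiagonal.antidiagonal n, lam p.1 x * lam p.2 y
  lam_of_one : ∀ n, 2 ≤ n → lam n 1 = 0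
  lam_mul : ∀ n x y, lam n (x * y) =
    aeval (Sum.elim (fun i : Fin n => lam (i + 1) x) (fun j : Fin n => lam (j + 1) y))
      (productPolynomial n)
  lam_lam : ∀ m n x, lam m (lam n x) =
    aeval (fun i : Fin (m * n) => lam (i + 1) x) (compositionPolynomial m n)

/-- The power series `λ_t(x) = ∑ λ^n(x) t^n`. -/
def lambdaSeries {R : Type*} [LambdaRing R] (x : R) : PowerSeries R :=
  PowerSeries.mk fun n => LambdaRing.lam n x

/-! ### Symmetric functions

The ring `Λ = ℤ[e_1, e_2, …]` of symmetric functions is `MvPolynomial ℕ ℤ`, the variable with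
index `i` standing for `e_{i+1}`. Partitions are Young diagrams: `π.rowLen i` is `π_{i+1}` and
`π.colLen j` is the part `π'_{j+1}` of the conjugate partition; `μ ≤ π` means that `π` contains `μ`. -/

/-- The homomorphism from `Λ` to `ℤ[ξ_1, …, ξ_n]` that sends each `e_i` to the `i`-th elementary
symmetric polynomial, i.e. setting `ξ_r = 0` for `r > n` in a symmetric function. -/
def restrictVars (n : ℕ) : MvPolynomial ℕ ℤ →ₐ[ℤ] MvPolynomial (Fin n) ℤ :=
  aeval fun i => esymm (Fin n) ℤ (i + 1)

/-- The alternating polynomial `det (ξ_i ^ (π_j + n - j))_{1 ≤ i, j ≤ n}`. -/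
def alternant (n : ℕ) (π : YoungDiagram) : MvPolynomial (Fin n) ℤ :=
  Matrix.det (Matrix.of fun i j : Fin n => X i ^ (π.rowLen j + (n - 1 - j)))

/-- `F ∈ Λ` is the Schur function `s_π`: in any number `n` of variables that is at least the number
of parts of `π`, it is the quotient of `det (ξ_i ^ (π_j + n - j))` by the Vandermonde determinant
`det (ξ_i ^ (n - j))`. There is exactly one such `F`. -/
def IsSchurFunction (π : YoungDiagram) (F : MvPolynomial ℕ ℤ) : Prop :=
  ∀ n, π.colLen 0 ≤ n → restrictVars n F * alternant n ⊥ = alternant n π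

/-- The homomorphism `u_x : Λ → R` with `u_x(e_n) = λ^n(x)`; an element `f` of `Λ` acts on `R` as the
natural operation `f(x) = u_x(f)`. -/
def evalAt {R : Type*} [LambdaRing R] (x : R) : MvPolynomial ℕ ℤ →ₐ[ℤ] R :=
  aeval fun i => LambdaRing.lam (i + 1) x

/-- `x` is Schur-finite: there is a partition `μ` such that `s_π(x) = 0` for all `π` containing `μ`. -/
def IsSchurFinite {R : Type*} [LambdaRing R] (x : R) : Prop :=
  ∃ μ : YoungDiagram, ∀ π : YoungDiagram, μ ≤ π →
    ∃ F : MvPolynomial ℕ ℤ, IsSchurFunction π F ∧ evalAt x F = 0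

/-! ### Rationality of power series -/

/-- The coefficient `r_k` of `f = ∑ r_n t^n`, with `r_k = 0` for negative `k`. -/
def intCoeff {R : Type*} [CommRing R] (f : PowerSeries R) (k : ℤ) : R :=
  if 0 ≤ k then PowerSeries.coeff k.toNat f else 0

/-- The Jacobi–Trudi determinant `s_π(f) = det (r_{π'_i + j - i})_{1 ≤ i, j ≤ m}`, where `m` is the
number of columns of `π`. -/
def jacobiTrudi {R : Type*} [CommRing R] (π : YoungDiagram) (f : PowerSeries R) : R :=
  Matrix.det (Matrix.of fun i j : Fin (π.rowLen 0) =>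
    intCoeff f ((π.colLen i : ℤ) + (j : ℤ) - (i : ℤ)))

/-- `f` is Schur-rational: for some partition `μ`, `s_π(f) = 0` for all `π` containing `μ`. -/
def IsSchurRational {R : Type*} [CommRing R] (f : PowerSeries R) : Prop :=
  ∃ μ : YoungDiagram, ∀ π : YoungDiagram, μ ≤ π → jacobiTrudi π f = 0

/-- `f = ∑ r_n t^n` is determinantally rational: for some `m, n₀ > 0` the Hankel determinants
`det (r_{n+i+j})_{1 ≤ i, j ≤ m}` vanish for all `n > n₀`. -/
def IsDeterminantallyRational {R : Type*} [CommRing R] (f : PowerSeries R) : Prop :=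
  ∃ m n₀ : ℕ, 0 < m ∧ 0 < n₀ ∧ ∀ n, n₀ < n →
    Matrix.det (Matrix.of fun i j : Fin m =>
      PowerSeries.coeff (n + ((i : ℕ) + 1) + ((j : ℕ) + 1)) f) = 0

end SchurFinite

end

noncomputable section

namespace SchurFinite

open Finset

/-! ### Complementary exponents -/

/-! The heart is the dual Jacobi–Trudi identity `s_π = det(e_{π'_i+j-i})`. Given it, `u_x` carries
`s_π` to the Jacobi–Trudi determinant of `λ_t(x)`, so both conditions hold for the same `μ`.

In `n` variables the identity comes from one matrix product (`det_coeff_mul_det_vandermonde`). Apply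
the functionals "value at `ξ_i`" and "coefficient of `T^{n+j}`" to the polynomials `T^s`, `s` an
exponent of the alternant, and `T^j P`, where `P = ∏ (T - ξ_i)`. Since `P` kills the `ξ_i` and is
monic, the product has the alternant of `π` as determinant. The factors contribute a Vandermonde
determinant and a minor of signed `e_k` at the complementary exponents; `sign_exponentPerm` matches
the signs. `IsSchurFunction.unique` lifts the result to `Λ`.

For determinantal rationality, apply the vanishing to rectangles: their Jacobi–Trudi determinants
are Toeplitz, and reversing the rows makes them Hankel. -/

/-- The exponents `π_i + n - i` (in increasing order) followed by the complementary exponents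
`n + j - 1 - π'_j`. -/
def exponent (n m : ℕ) (π : YoungDiagram) : Fin n ⊕ Fin m → ℕ :=
  Sum.elim (fun i => π.rowLen (n - 1 - i) + i) (fun j => n + j - π.colLen j)

theorem lt_rowLen_iff_lt_colLen (π : YoungDiagram) {i j : ℕ} :
    j < π.rowLen i ↔ i < π.colLen j := by
  rw [← YoungDiagram.mem_iff_lt_rowLen, YoungDiagram.mem_iff_lt_colLen]

section exponent

variable {n m : ℕ} {π : YoungDiagram}

theorem exponent_inl_lt_inl {i i' : Fin n} (h : i < i') :
    exponent n m π (.inl i) < exponent n m π (.inl i') := by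
  have h' : (i : ℕ) < i' := h
  have := π.rowLen_anti (n - 1 - i') (n - 1 - i) (by omega)
  simp only [exponent, Sum.elim_inl]
  omega

theorem exponent_inr_lt_inr (hn : π.colLen 0 ≤ n) {j j' : Fin m} (h : j < j') :
    exponent n m π (.inr j) < exponent n m π (.inr j') := by
  have h' : (j : ℕ) < j' := h
  have := π.colLen_anti j j' h'.le
  have := π.colLen_anti 0 j (Nat.zero_le _)
  simp only [exponent, Sum.elim_inr]
  omega

/-- An exponent of the first kind exceeds one of the second kind exactly when the box in row `n - 1
- i`, column `j` belongs to `π`; this is the case of a box outside `π`. -/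
theorem exponent_inl_lt_inr {i : Fin n} {j : Fin m}
    (h : π.colLen j ≤ n - 1 - i) : exponent n m π (.inl i) < exponent n m π (.inr j) := by
  have h1 : ¬ (j : ℕ) < π.rowLen (n - 1 - i) := by rw [lt_rowLen_iff_lt_colLen]; omega
  have := i.2
  simp only [exponent, Sum.elim_inl, Sum.elim_inr]
  omega

theorem exponent_inr_lt_inl {i : Fin n} {j : Fin m}
    (h : n - 1 - i < π.colLen j) : exponent n m π (.inr j) < exponent n m π (.inl i) := by
  have h1 : (j : ℕ) < π.rowLen (n - 1 - i) := by rwa [lt_rowLen_iff_lt_colLen]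
  have := i.2
  simp only [exponent, Sum.elim_inl, Sum.elim_inr]
  omega

theorem exponent_injective (hn : π.colLen 0 ≤ n) : Function.Injective (exponent n m π) := by
  rintro (i | j) (i' | j') h
  · rcases lt_trichotomy i i' with h' | h' | h'
    · exact absurd h (exponent_inl_lt_inl h').ne
    · rw [h']
    · exact absurd h (exponent_inl_lt_inl h').ne'
  · rcases le_or_gt (π.colLen j') (n - 1 - i) with h' | h'
    · exact absurd h (exponent_inl_lt_inr h').ne
    · exact absurd h (exponent_inr_lt_inl h').ne'
  · rcases le_or_gt (π.colLen j) (n - 1 - i') with h' | h'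
    · exact absurd h (exponent_inl_lt_inr h').ne'
    · exact absurd h (exponent_inr_lt_inl h').ne
  · rcases lt_trichotomy j j' with h' | h' | h'
    · exact absurd h (exponent_inr_lt_inr hn h').ne
    · rw [h']
    · exact absurd h (exponent_inr_lt_inr hn h').ne'

theorem exponent_lt (hm : π.rowLen 0 ≤ m) (a : Fin n ⊕ Fin m) : exponent n m π a < n + m := by
  rcases a with i | j
  · have := π.rowLen_anti 0 (n - 1 - i) (Nat.zero_le _)
    have := i.2
    simp only [exponent, Sum.elim_inl]
    omega
  · have := j.2
    simp only [exponent, Sum.elim_inr]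
    omega

/-- The exponents, as a permutation of `{0, …, n + m - 1}`. -/
def exponentPerm (hn : π.colLen 0 ≤ n) (hm : π.rowLen 0 ≤ m) : Equiv.Perm (Fin (n + m)) :=
  Equiv.ofBijective
    (fun k => ⟨exponent n m π (finSumFinEquiv.symm k), exponent_lt hm _⟩)
    (Finite.injective_iff_bijective.1 fun _ _ h => finSumFinEquiv.symm.injective
      (exponent_injective hn (congrArg Fin.val h)))

theorem val_exponentPerm (hn : π.colLen 0 ≤ n) (hm : π.rowLen 0 ≤ m) (a : Fin n ⊕ Fin m) :
    (exponentPerm hn hm (finSumFinEquiv a) : ℕ) = exponent n m π a := by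
  simp [exponentPerm]

/-- Each of the two lists is increasing, so inversions occur only between them, and they correspond
to the boxes of `π`. -/
theorem sign_exponentPerm (hn : π.colLen 0 ≤ n) (hm : π.rowLen 0 ≤ m) :
    (exponentPerm hn hm).sign = ∏ j : Fin m, (-1) ^ π.colLen j := by
  have key : ∀ a b, exponentPerm hn hm (finSumFinEquiv a) < exponentPerm hn hm (finSumFinEquiv b) ↔
      exponent n m π a < exponent n m π b := fun a b => by
    rw [Fin.lt_def, val_exponentPerm, val_exponentPerm]
  have hI : ∀ (k : Fin (n + m)) (g : Fin (n + m) → ℤˣ),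
      ∏ l ∈ Ioi k, g l = ∏ l, if k < l then g l else 1 := fun k g => by
    rw [← prod_filter]; congr 1; ext; simp
  simp only [Equiv.Perm.sign_eq_prod_prod_Ioi, hI]
  rw [← finSumFinEquiv.prod_comp, Fintype.prod_sum_type]
  have h2 : ∀ a : Fin n ⊕ Fin m, (∏ l, if finSumFinEquiv a < l then
      (if exponentPerm hn hm (finSumFinEquiv a) < exponentPerm hn hm l then (1 : ℤˣ) else -1)
        else 1) = ∏ b, if finSumFinEquiv a < finSumFinEquiv b then
          (if exponent n m π a < exponent n m π b then 1 else -1) else 1 := fun a => by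
    rw [← finSumFinEquiv.prod_comp]
    simp only [key]
  simp only [h2, Fintype.prod_sum_type]
  have hll : ∀ i i' : Fin n, (if finSumFinEquiv (.inl i : Fin n ⊕ Fin m) < finSumFinEquiv (.inl i')
      then (if exponent n m π (.inl i) < exponent n m π (.inl i') then (1 : ℤˣ) else -1)
        else 1) = 1 := fun i i' => by
    split_ifs with h1 h2
    · rfl
    · simp only [finSumFinEquiv_apply_left, Fin.lt_def, Fin.val_castAdd] at h1
      exact absurd (exponent_inl_lt_inl h1) h2
    · rfl
  have hrr : ∀ j j' : Fin m, (if finSumFinEquiv (.inr j : Fin n ⊕ Fin m) < finSumFinEquiv (.inr j')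
      then (if exponent n m π (.inr j) < exponent n m π (.inr j') then (1 : ℤˣ) else -1)
        else 1) = 1 := fun j j' => by
    split_ifs with h1 h2
    · rfl
    · simp only [finSumFinEquiv_apply_right, Fin.lt_def, Fin.val_natAdd] at h1
      exact absurd (exponent_inr_lt_inr hn (Nat.lt_of_add_lt_add_left h1)) h2
    · rfl
  have hrl : ∀ (j : Fin m) (i : Fin n), (if finSumFinEquiv (.inr j : Fin n ⊕ Fin m) <
      finSumFinEquiv (.inl i) then
        (if exponent n m π (.inr j) < exponent n m π (.inl i) then (1 : ℤˣ) else -1)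
        else 1) = 1 := fun j i => by
    rw [if_neg]
    simp [Fin.lt_def]
    omega
  have hlr : ∀ (i : Fin n) (j : Fin m), (if finSumFinEquiv (.inl i : Fin n ⊕ Fin m) <
      finSumFinEquiv (.inr j) then
        (if exponent n m π (.inl i) < exponent n m π (.inr j) then (1 : ℤˣ) else -1)
        else 1) = if n - 1 - (i : ℕ) < π.colLen j then -1 else 1 := fun i j => by
    rw [if_pos (by simp [Fin.lt_def]; omega)]
    split_ifs with h1 h2 h2
    · exact absurd h1 (exponent_inr_lt_inl h2).asymm
    · rfl
    · rfl
    · exact absurd (exponent_inl_lt_inr (not_lt.1 h2)) h1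
  simp only [hll, hrr, hrl, hlr, prod_const_one, one_mul, mul_one]
  rw [prod_comm]
  refine prod_congr rfl fun j _ => ?_
  have hj := π.colLen_anti 0 j (Nat.zero_le _)
  -- Reversal turns `n - 1 - i` into a row index; by `hj` and `hn` all boxes of column `j` lie in
  -- the first `n` rows.
  rw [← Equiv.prod_comp Fin.revPerm]
  have h3 : ∀ i : Fin n, n - 1 - ((Fin.revPerm i : Fin n) : ℕ) = i := fun i => by
    have := i.2
    simp [Fin.val_rev]
    omega
  simp only [h3]
  rw [Fin.prod_univ_eq_prod_range (fun i => if i < π.colLen j then (-1 : ℤˣ) else 1) n,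
    ← prod_filter, prod_const]
  congr 1
  rw [show (range n).filter (fun i => i < π.colLen j) = range (π.colLen j) by
    ext; simp only [mem_filter, mem_range]; omega, card_range]

end exponent

/-! ### The dual Jacobi–Trudi identity -/

section DualJacobiTrudi

open Polynomial Matrix

variable {A : Type*} [CommRing A] {n m : ℕ} {π : YoungDiagram}

/-- The columns are the coefficients of `X ^ s`, for the first `n` exponents `s`, and of
`X ^ j * P`. -/
def columnPoly (n m : ℕ) (π : YoungDiagram) (P : A[X]) : Fin n ⊕ Fin m → A[X] :=
  Sum.elim (fun i => X ^ exponent n m π (.inl i)) (fun j => X ^ (j : ℕ) * P)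

theorem natDegree_columnPoly_lt (hm : π.rowLen 0 ≤ m) {P : A[X]} (hP : P.natDegree ≤ n)
    (a : Fin n ⊕ Fin m) : (columnPoly n m π P a).natDegree < n + m := by
  rcases a with i | j
  · exact (natDegree_X_pow_le _).trans_lt (exponent_lt hm _)
  · refine (natDegree_mul_le.trans (add_le_add (natDegree_X_pow_le _) hP)).trans_lt ?_
    have := j.2
    omega

/-- Evaluation at `x_1, …, x_n` and the coefficients of degree at least `n`. -/
def evalCoeffMatrix (m : ℕ) (x : Fin n → A) : Matrix (Fin n ⊕ Fin m) (Fin (n + m)) A :=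
  of fun a c => Sum.elim (fun i => x i ^ (c : ℕ)) (fun j : Fin m => if (c : ℕ) = n + j then 1 else 0) a

/-- Both sides compute `det (M * N)`: the left from the factors, after reordering the inner index by
the exponents, the right from the block form of the product. -/
theorem det_coeff_mul_det_vandermonde (hn : π.colLen 0 ≤ n) (hm : π.rowLen 0 ≤ m) (x : Fin n → A)
    {P : A[X]} (hP : P.natDegree ≤ n) (hP1 : P.coeff n = 1) (hx : ∀ i, P.eval (x i) = 0) :
    ((exponentPerm hn hm).sign : A) * (vandermonde x).det *
      (of fun i j : Fin m => (X ^ (j : ℕ) * P).coeff (exponent n m π (.inr i))).det =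
    (of fun i j : Fin n => x i ^ exponent n m π (.inl j)).det := by
  set τ := exponentPerm hn hm with hτ
  let e : Fin n ⊕ Fin m ≃ Fin (n + m) := finSumFinEquiv
  let M := evalCoeffMatrix m x
  let N : Matrix (Fin (n + m)) (Fin n ⊕ Fin m) A := of fun c a => (columnPoly n m π P a).coeff c
  have hM : (M.submatrix id (e.trans τ)).det = (τ.sign : A) * (vandermonde x).det := by
    have h1 : M.submatrix id (e.trans τ) = (M.submatrix e.symm τ).submatrix e e := by
      ext; simp
    have h2 : M.submatrix e.symm τ = (M.submatrix e.symm id).submatrix id τ := rfl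
    have h3 : (M.submatrix e.symm id) = (M.submatrix id e).submatrix e.symm e.symm := by
      ext; simp
    have h4 : M.submatrix id e = fromBlocks (vandermonde x)
        (of fun i (j : Fin m) => x i ^ (n + j : ℕ)) 0 1 := by
      ext (i | i) (j | j)
      · simp [M, e, evalCoeffMatrix, vandermonde_apply]
      · simp [M, e, evalCoeffMatrix]
      · have := j.2
        simp [M, e, evalCoeffMatrix]
        omega
      · simp [M, e, evalCoeffMatrix, one_apply, Fin.ext_iff, eq_comm]
    rw [h1, det_submatrix_equiv_self, h2, det_permute', h3, det_submatrix_equiv_self, h4,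
      det_fromBlocks_zero₂₁, det_one, mul_one]
  have hN : (N.submatrix (e.trans τ) id).det =
      (of fun i j : Fin m => (X ^ (j : ℕ) * P).coeff (exponent n m π (.inr i))).det := by
    have hc : ∀ a b, N.submatrix (e.trans τ) id a b =
        (columnPoly n m π P b).coeff (exponent n m π a) := fun a b => by
      simp [N, e, hτ, val_exponentPerm]
    -- With rows ordered by exponent, the monomial columns become unit vectors, leaving the minor at
    -- the complementary exponents.
    have h1 : N.submatrix (e.trans τ) id = fromBlocks 1
        (of fun i j => (X ^ (j : ℕ) * P).coeff (exponent n m π (.inl i))) 0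
        (of fun i j : Fin m => (X ^ (j : ℕ) * P).coeff (exponent n m π (.inr i))) := by
      ext (i | i) (j | j)
      · rw [hc]
        simp [columnPoly, coeff_X_pow, one_apply, (exponent_injective hn).eq_iff]
      · rw [hc]; rfl
      · rw [hc]
        simp [columnPoly, coeff_X_pow, (exponent_injective hn).eq_iff]
      · rw [hc]; rfl
    rw [h1, det_fromBlocks_zero₂₁, det_one, one_mul]
  rw [← hM, ← hN, ← det_mul, submatrix_mul_equiv, submatrix_id_id]
  have hl : ∀ i b, (M * N) (.inl i) b = (columnPoly n m π P b).eval (x i) := fun i b => by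
    rw [eval_eq_sum_range' (natDegree_columnPoly_lt hm hP b), mul_apply,
      ← Fin.sum_univ_eq_sum_range
        (fun c => (columnPoly n m π P b).coeff c * x i ^ c)]
    exact sum_congr rfl fun c _ => mul_comm _ _
  have hr : ∀ j b, (M * N) (.inr j) b = (columnPoly n m π P b).coeff (n + j) := fun j b => by
    rw [mul_apply, sum_eq_single (Fin.natAdd n j)]
    · simp [M, N, evalCoeffMatrix]
    · intro c _ hc
      have : (c : ℕ) ≠ n + j := fun h => hc (Fin.ext h)
      simp [M, evalCoeffMatrix, this]
    · simp
  -- The zero block expresses that `X ^ j * P` vanishes at every `x i`.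
  have hMN : M * N = fromBlocks (of fun i j => x i ^ exponent n m π (.inl j)) 0
      (of fun (i : Fin m) j => (X ^ exponent n m π (.inl j) : A[X]).coeff (n + i))
      (of fun i j : Fin m => (X ^ (j : ℕ) * P).coeff (n + i)) := by
    ext (i | i) (j | j)
    · rw [hl]; simp [columnPoly]
    · rw [hl]; simp [columnPoly, hx]
    · rw [hr]; rfl
    · rw [hr]; rfl
  rw [hMN, det_fromBlocks_zero₁₂]
  have hU : (of fun i j : Fin m => (X ^ (j : ℕ) * P).coeff (n + i)).det = 1 := by
    rw [det_of_isUpperTriangular]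
    · refine prod_eq_one fun i _ => ?_
      simp [coeff_X_pow_mul', hP1]
    · intro i j hij
      have hij' : (j : ℕ) < i := hij
      rw [of_apply, coeff_X_pow_mul', if_pos (by omega)]
      exact coeff_eq_zero_of_natDegree_lt (by omega)
  rw [hU, mul_one]

end DualJacobiTrudi

end SchurFinite

end

noncomputable section

namespace SchurFinite

/-! ### Schur functions as Jacobi–Trudi determinants -/

section SchurFunction

open MvPolynomial Matrix

theorem map_intCoeff {R S : Type*} [CommRing R] [CommRing S] (φ : R →+* S) (f : PowerSeries R)
    (k : ℤ) : φ (intCoeff f k) = intCoeff (PowerSeries.map φ f) k := by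
  unfold intCoeff
  split_ifs <;> simp

theorem map_jacobiTrudi {R S : Type*} [CommRing R] [CommRing S] (φ : R →+* S)
    (π : YoungDiagram) (f : PowerSeries R) :
    φ (jacobiTrudi π f) = jacobiTrudi π (PowerSeries.map φ f) := by
  unfold jacobiTrudi
  rw [RingHom.map_det]
  congr 1
  ext i j
  simp [map_intCoeff]

/-- `exponent` is increasing while the alternant lists its exponents in decreasing order. The sign
does not depend on `π`, so the Vandermonde determinant acquires the same one. -/
theorem alternant_eq_sign_mul_det (n m : ℕ) (π : YoungDiagram) :
    alternant n π = ((Fin.revPerm (n := n)).sign : MvPolynomial (Fin n) ℤ) *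
      (of fun i j : Fin n => (X i : MvPolynomial (Fin n) ℤ) ^ exponent n m π (.inl j)).det := by
  rw [← det_permute']
  unfold alternant
  congr 1
  ext1 i j
  have := j.2
  have h : n - 1 - (n - (j + 1 : ℕ)) = j := by omega
  simp only [of_apply, submatrix_apply, id, exponent, Sum.elim_inl, Fin.revPerm_apply, Fin.val_rev,
    h]
  congr 2
  omega

theorem alternant_bot_eq_sign_mul_det_vandermonde (n : ℕ) :
    alternant n ⊥ = ((Fin.revPerm (n := n)).sign : MvPolynomial (Fin n) ℤ) *
      (vandermonde (X : Fin n → MvPolynomial (Fin n) ℤ)).det := by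
  have h : ∀ i, (⊥ : YoungDiagram).rowLen i = 0 := fun i => by
    simp [YoungDiagram.rowLen_eq_card, YoungDiagram.row]
  rw [alternant_eq_sign_mul_det n 0]
  simp [exponent, h, vandermonde]

theorem alternant_bot_ne_zero (n : ℕ) : alternant n ⊥ ≠ 0 := by
  rw [alternant_bot_eq_sign_mul_det_vandermonde]
  refine mul_ne_zero ?_ (det_vandermonde_ne_zero_iff.2 X_injective)
  exact ((Units.isUnit _).map (Int.castRingHom (MvPolynomial (Fin n) ℤ))).ne_zero

/-- The polynomial `∏ (T - ξ_i)`. -/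
def rootPoly (n : ℕ) : Polynomial (MvPolynomial (Fin n) ℤ) :=
  ∏ i, (Polynomial.X - Polynomial.C (X i))

theorem monic_rootPoly (n : ℕ) : (rootPoly n).Monic :=
  Polynomial.monic_prod_of_monic _ _ fun _ _ => Polynomial.monic_X_sub_C _

theorem natDegree_rootPoly (n : ℕ) : (rootPoly n).natDegree = n := by
  rw [rootPoly, Polynomial.natDegree_prod_of_monic _ _ fun _ _ => Polynomial.monic_X_sub_C _]
  simp

theorem eval_rootPoly (n : ℕ) (i : Fin n) : (rootPoly n).eval (X i) = 0 := by
  rw [rootPoly, Polynomial.eval_prod]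
  exact Finset.prod_eq_zero (Finset.mem_univ i) (by simp)

theorem coeff_rootPoly {n k : ℕ} (h : k ≤ n) :
    (rootPoly n).coeff k = (-1) ^ (n - k) * esymm (Fin n) ℤ (n - k) := by
  have := Multiset.prod_X_sub_C_coeff
    (Finset.univ.val.map (X : Fin n → MvPolynomial (Fin n) ℤ)) (k := k) (by simpa using h)
  rw [Multiset.map_map, Multiset.card_map, Finset.card_val, Finset.card_univ, Fintype.card_fin,
    ← esymm_eq_multiset_esymm] at this
  exact this

/-- The generating series of the elementary symmetric polynomials. -/
def esymmSeries (n : ℕ) : PowerSeries (MvPolynomial (Fin n) ℤ) :=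
  PowerSeries.mk fun k => esymm (Fin n) ℤ k

theorem intCoeff_esymmSeries_natCast (n k : ℕ) :
    intCoeff (esymmSeries n) k = esymm (Fin n) ℤ k := by
  simp [intCoeff, esymmSeries]

/-- The sign is split into a row factor and a column factor, to be pulled out of the determinant.
Outside the range `0 ≤ p + j - i ≤ n` both sides vanish. -/
theorem coeff_X_pow_mul_rootPoly {n p i j : ℕ} (hp : p ≤ n) :
    (Polynomial.X ^ j * rootPoly n).coeff (n + i - p) =
      (-1) ^ (p + i) * ((-1) ^ j * intCoeff (esymmSeries n) (p + j - i)) := by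
  rw [Polynomial.coeff_X_pow_mul']
  split_ifs with h
  · rcases le_or_gt i (p + j) with hk | hk
    · have e1 : (p + j - i : ℤ) = ((p + j - i : ℕ) : ℤ) := by omega
      rw [coeff_rootPoly (by omega), e1, intCoeff_esymmSeries_natCast, ← mul_assoc, ← pow_add,
        show n - (n + i - p - j) = p + j - i by omega,
        show p + i + j = (p + j - i) + 2 * i by omega, pow_add _ _ (2 * i), pow_mul, neg_one_sq,
        one_pow, mul_one]
    · rw [Polynomial.coeff_eq_zero_of_natDegree_lt (by rw [natDegree_rootPoly]; omega), intCoeff,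
        if_neg (by omega)]
      simp
  · have e1 : (p + j - i : ℤ) = ((p + j - i : ℕ) : ℤ) := by omega
    rw [e1, intCoeff_esymmSeries_natCast, esymm, Finset.powersetCard_eq_empty.2 (by simp; omega)]
    simp

theorem jacobiTrudi_esymmSeries_mul_alternant_bot {n : ℕ} {π : YoungDiagram}
    (hn : π.colLen 0 ≤ n) : jacobiTrudi π (esymmSeries n) * alternant n ⊥ = alternant n π := by
  have hmon : (rootPoly n).coeff n = 1 := by
    simpa [Polynomial.leadingCoeff, natDegree_rootPoly] using (monic_rootPoly n).leadingCoeff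
  have key := det_coeff_mul_det_vandermonde hn le_rfl X (natDegree_rootPoly n).le hmon
    (eval_rootPoly n)
  have hc : ∀ j, π.colLen j ≤ n := fun j => (π.colLen_anti 0 j (Nat.zero_le _)).trans hn
  have hdet : (of fun i j : Fin (π.rowLen 0) => (Polynomial.X ^ (j : ℕ) * rootPoly n).coeff
      (exponent n _ π (.inr i))).det =
      (∏ j : Fin (π.rowLen 0), (-1) ^ π.colLen j) * jacobiTrudi π (esymmSeries n) := by
    simp only [exponent, Sum.elim_inr, coeff_X_pow_mul_rootPoly (hc _)]
    -- The factors `(-1) ^ i` from rows and `(-1) ^ j` from columns cancel, leaving the sign of the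
    -- exponent permutation.
    have h1 := det_mul_column (fun i : Fin (π.rowLen 0) =>
      ((-1) ^ (π.colLen i + i : ℕ) : MvPolynomial (Fin n) ℤ))
      (of fun i j => (-1) ^ (j : ℕ) * intCoeff (esymmSeries n) (π.colLen i + j - i))
    have h2 := det_mul_row (fun j : Fin (π.rowLen 0) =>
      ((-1) ^ (j : ℕ) : MvPolynomial (Fin n) ℤ))
      (of fun i j => intCoeff (esymmSeries n) (π.colLen i + j - i))
    simp only [of_apply] at h1 h2
    rw [h1, h2, ← mul_assoc, ← Finset.prod_mul_distrib, jacobiTrudi]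
    congr 1
    refine Finset.prod_congr rfl fun i _ => ?_
    rw [pow_add, mul_assoc, ← pow_add, ← two_mul, pow_mul, neg_one_sq, one_pow, mul_one]
  have hs : (((exponentPerm hn (le_refl (π.rowLen 0))).sign : ℤ) : MvPolynomial (Fin n) ℤ) =
      ∏ j : Fin (π.rowLen 0), (-1) ^ π.colLen j := by
    rw [sign_exponentPerm]
    simp
  have hsq : (∏ j : Fin (π.rowLen 0), (-1 : MvPolynomial (Fin n) ℤ) ^ π.colLen j) *
      ∏ j : Fin (π.rowLen 0), (-1) ^ π.colLen j = 1 := by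
    rw [← Finset.prod_mul_distrib]
    refine Finset.prod_eq_one fun j _ => ?_
    rw [← pow_add, ← two_mul, pow_mul, neg_one_sq, one_pow]
  rw [hdet, hs] at key
  rw [alternant_bot_eq_sign_mul_det_vandermonde, alternant_eq_sign_mul_det n (π.rowLen 0), ← key]
  linear_combination (-(Fin.revPerm (n := n)).sign : MvPolynomial (Fin n) ℤ) *
    (vandermonde (X : Fin n → MvPolynomial (Fin n) ℤ)).det * jacobiTrudi π (esymmSeries n) * hsq

/-! ### From finitely many variables to `Λ` -/

/-- The generating series of the elementary symmetric functions. -/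
def elementarySeries : PowerSeries (MvPolynomial ℕ ℤ) :=
  PowerSeries.mk fun k => if k = 0 then 1 else X (k - 1)

theorem map_restrictVars_elementarySeries (n : ℕ) :
    PowerSeries.map (restrictVars n : _ →+* MvPolynomial (Fin n) ℤ) elementarySeries =
      esymmSeries n := by
  ext1 k
  rcases k with _ | k <;> simp [elementarySeries, esymmSeries, restrictVars]

theorem isSchurFunction_jacobiTrudi (π : YoungDiagram) :
    IsSchurFunction π (jacobiTrudi π elementarySeries) := fun n hn => by
  rw [← jacobiTrudi_esymmSeries_mul_alternant_bot hn, ← map_restrictVars_elementarySeries,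
    ← map_jacobiTrudi]
  rfl

/-- `F` involves only finitely many `e_i`, and `e_1, …, e_n` are algebraically independent in `n`
variables; take `n` large. -/
theorem eq_zero_of_restrictVars_eq_zero {F : MvPolynomial ℕ ℤ} {N : ℕ}
    (h : ∀ n, N ≤ n → restrictVars n F = 0) : F = 0 := by
  obtain ⟨s, q, rfl⟩ := exists_finset_rename F
  obtain ⟨k, hk⟩ := s.exists_nat_subset_range
  let n := max k N
  let g : s → Fin n := fun i =>
    ⟨i, (Finset.mem_range.1 (hk i.2)).trans_le (le_max_left _ _)⟩
  have hg : Function.Injective g := fun a b hab => Subtype.ext (congrArg Fin.val hab)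
  have h1 : esymmAlgHom (Fin n) ℤ n (rename g q) = 0 := by
    apply Subtype.ext
    rw [esymmAlgHom_apply, aeval_rename]
    have := h n (le_max_right _ _)
    rwa [restrictVars, aeval_rename] at this
  have h2 : rename g q = 0 :=
    esymmAlgHom_fin_injective ℤ (le_refl n) (h1.trans (map_zero _).symm)
  rw [rename_injective g hg (h2.trans (map_zero _).symm), map_zero]

theorem IsSchurFunction.unique {π : YoungDiagram} {F G : MvPolynomial ℕ ℤ}
    (hF : IsSchurFunction π F) (hG : IsSchurFunction π G) : F = G := by
  refine sub_eq_zero.1 (eq_zero_of_restrictVars_eq_zero (N := π.colLen 0) fun n hn => ?_)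
  rw [map_sub, sub_eq_zero]
  exact mul_right_cancel₀ (alternant_bot_ne_zero n) ((hF n hn).trans (hG n hn).symm)

end SchurFunction

/-! ### Schur-finiteness and rationality -/

section LambdaRing

variable {R : Type*} [LambdaRing R]

theorem map_evalAt_elementarySeries (x : R) :
    PowerSeries.map (evalAt x : _ →+* R) elementarySeries = lambdaSeries x := by
  ext1 k
  rcases k with _ | k <;>
    simp [elementarySeries, lambdaSeries, evalAt, LambdaRing.lam_zero]

theorem exists_isSchurFunction_evalAt_eq_zero_iff (x : R) (π : YoungDiagram) :
    (∃ F, IsSchurFunction π F ∧ evalAt x F = 0) ↔ jacobiTrudi π (lambdaSeries x) = 0 := by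
  have h : evalAt x (jacobiTrudi π elementarySeries) = jacobiTrudi π (lambdaSeries x) := by
    rw [← map_evalAt_elementarySeries, ← map_jacobiTrudi]
    rfl
  rw [← h]
  constructor
  · rintro ⟨F, hF, h0⟩
    rwa [← hF.unique (isSchurFunction_jacobiTrudi π)]
  · exact fun h0 => ⟨_, isSchurFunction_jacobiTrudi π, h0⟩

theorem isSchurFinite_iff_isSchurRational (x : R) :
    IsSchurFinite x ↔ IsSchurRational (lambdaSeries x) := by
  simp only [IsSchurFinite, IsSchurRational, exists_isSchurFunction_evalAt_eq_zero_iff]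

end LambdaRing

/-! ### Rectangles and Hankel determinants -/

/-- The Young diagram with `k` rows of length `m`. -/
def rectangle (k m : ℕ) : YoungDiagram where
  cells := Finset.range k ×ˢ Finset.range m
  isLowerSet := by
    rintro ⟨i, j⟩ ⟨i', j'⟩ ⟨hi : i' ≤ i, hj : j' ≤ j⟩ h
    simp only [Finset.coe_product, Finset.coe_range, Set.mem_prod, Set.mem_Iio] at h ⊢
    exact ⟨hi.trans_lt h.1, hj.trans_lt h.2⟩

theorem mem_rectangle {k m i j : ℕ} : (i, j) ∈ rectangle k m ↔ i < k ∧ j < m := by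
  rw [← YoungDiagram.mem_cells]
  simp [rectangle]

theorem rowLen_rectangle {k m i : ℕ} (hi : i < k) : (rectangle k m).rowLen i = m :=
  eq_of_forall_lt_iff fun j => by rw [← YoungDiagram.mem_iff_lt_rowLen, mem_rectangle]; simp [hi]

theorem colLen_rectangle {k m j : ℕ} (hj : j < m) : (rectangle k m).colLen j = k :=
  eq_of_forall_lt_iff fun i => by rw [← YoungDiagram.mem_iff_lt_colLen, mem_rectangle]; simp [hj]

theorem le_rectangle {μ : YoungDiagram} {k m : ℕ} (hk : μ.colLen 0 ≤ k) (hm : μ.rowLen 0 ≤ m) :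
    μ ≤ rectangle k m := by
  rintro ⟨i, j⟩ h
  change (i, j) ∈ μ at h
  have h1 := YoungDiagram.mem_iff_lt_rowLen.1 h
  have h2 := YoungDiagram.mem_iff_lt_colLen.1 h
  have h3 := μ.rowLen_anti 0 i (Nat.zero_le _)
  have h4 := μ.colLen_anti 0 j (Nat.zero_le _)
  exact mem_rectangle.2 ⟨by omega, by omega⟩

theorem jacobiTrudi_rectangle {R : Type*} [CommRing R] (f : PowerSeries R) {k m : ℕ} (hk : 0 < k) :
    jacobiTrudi (rectangle k m) f =
      Matrix.det (Matrix.of fun i j : Fin m => intCoeff f ((k : ℤ) + j - i)) := by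
  rw [jacobiTrudi,
    ← Matrix.det_submatrix_equiv_self (finCongr (rowLen_rectangle hk : _ = m)).symm]
  congr 1
  ext i j
  simp [colLen_rectangle i.2]

theorem IsSchurRational.isDeterminantallyRational {R : Type*} [CommRing R] {f : PowerSeries R}
    (hf : IsSchurRational f) : IsDeterminantallyRational f := by
  obtain ⟨μ, hμ⟩ := hf
  refine ⟨μ.rowLen 0 + 1, μ.colLen 0 + 1, Nat.succ_pos _, Nat.succ_pos _, fun n hn => ?_⟩
  -- With `m` columns and `n + m + 1` rows, replacing `i` by `m - 1 - i` turns the index `n + m + 1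
  -- + j - i` into `n + (i + 1) + (j + 1)`.
  have h := hμ (rectangle (n + (μ.rowLen 0 + 1) + 1) (μ.rowLen 0 + 1))
    (le_rectangle (by omega) (by omega))
  rw [jacobiTrudi_rectangle f (Nat.succ_pos _)] at h
  have h2 := Matrix.det_permute Fin.revPerm (Matrix.of fun i j : Fin (μ.rowLen 0 + 1) =>
    intCoeff f (((n + (μ.rowLen 0 + 1) + 1 : ℕ) : ℤ) + j - i))
  rw [h, mul_zero] at h2
  rw [← h2]
  congr 1
  ext1 i j
  have := i.2
  simp only [Matrix.of_apply, Matrix.submatrix_apply, id, Fin.revPerm_apply, Fin.val_rev, intCoeff]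
  rw [if_pos (by omega)]
  congr 2
  omega

end SchurFinite

end

theorem mainTheorem7 {R : Type*} [SchurFinite.LambdaRing R] (x : R) :
    (SchurFinite.IsSchurFinite x ↔
      SchurFinite.IsSchurRational (SchurFinite.lambdaSeries x)) ∧
    (SchurFinite.IsSchurFinite x →
      SchurFinite.IsDeterminantallyRational (SchurFinite.lambdaSeries x)) :=
  ⟨SchurFinite.isSchurFinite_iff_isSchurRational x, fun h =>
    ((SchurFinite.isSchurFinite_iff_isSchurRational x).1 h).isDeterminantallyRational⟩
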